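/- Let $G$ be a finite connected graph (loops and multiple edges allowed), and let "embedding of $G$" mean a 2-cell embedding of $G$ on a closed orientable surface, given by its rotation system. Thus, if $H$ is the set of half-edges of $G$ and $\alpha$ is the involution of $H$ exchanging the two halves of each edge, an embedding is a permutation $\beta$ of $H$ whose cycles are cyclic orders of the sets $H(v)$ of half-edges around the vertices $v$. The faces of the embedding are the cycles of $\gamma=\alpha\circ\beta$, and its genus $g$ is given by Euler's formula $\#\text{vertices}-\#\text{edges}+\#\text{faces}=2-2g$. (If $G$ is a single vertex without edges, there is one face, incident to that vertex.) Let $g_{\min}(G)$ and $g_{\max}(G)$ denote the minimum and the maximum genus of the embeddings of $G$. Let $\mathbb{E}$ be an embedding of $G$. For a vertex $v$ let $\deg(v)=|H(v)|$, and let $q_v$ be the number of faces of $\mathbb{E}$ incident to $v$, i.e. containing a half-edge of $H(v)$. Let $\pi_v$ be the restriction of $\beta$ to $H(v)$, let $s_v$ be the permutation of $H(v)$ obtained from the cycles of $\gamma$ by deleting all half-edges not in $H(v)$, put $D_v=s_v\circ\pi_v^{-1}$, and let $\ell(\lambda(D_v))$ be the number of cycles of $D_v$, fixed points included. Set $$T_1=\min_v\left\{-\left\lfloor\frac{\deg(v)+1-\ell(\lambda(D_v))-q_v}{2}\right\rfloor\right\},\qquad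 T_2=\max_v\left\{\left\lfloor\frac{q_v-1}{2}\right\rfloor\right\},$$ where $v$ ranges over all vertices of $G$. Then $$g_{\min}(G)\le g(\mathbb{E})+T_1\le g(\mathbb{E})+T_2\le g_{\max}(G).$$ -/

import Mathlib

open Equiv

theorem Equiv.Perm.exists_return {α : Type*} [Finite α] (σ : Perm α) (p : α → Prop)
    (x : {x // p x}) : ∃ n : ℕ, 0 < n ∧ p ((σ ^ n) x) :=
  ⟨orderOf σ, orderOf_pos σ, by simpa [pow_orderOf_eq_one] using x.2⟩

open Classical in
/-- The first positive time at which the orbit of `x` under `σ` returns to `{x | p x}`. -/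
noncomputable def Equiv.Perm.returnTime {α : Type*} [Finite α] (σ : Perm α) (p : α → Prop)
    (x : {x // p x}) : ℕ :=
  Nat.find (σ.exists_return p x)

theorem Equiv.Perm.returnTime_pos {α : Type*} [Finite α] (σ : Perm α) (p : α → Prop)
    (x : {x // p x}) : 0 < σ.returnTime p x := by
  classical exact (Nat.find_spec (σ.exists_return p x)).1

theorem Equiv.Perm.returnTime_spec {α : Type*} [Finite α] (σ : Perm α) (p : α → Prop)
    (x : {x // p x}) : p ((σ ^ σ.returnTime p x) x) := by
  classical exact (Nat.find_spec (σ.exists_return p x)).2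

theorem Equiv.Perm.returnTime_le {α : Type*} [Finite α] (σ : Perm α) (p : α → Prop)
    (x : {x // p x}) {n : ℕ} (hn : 0 < n) (h : p ((σ ^ n) x)) : σ.returnTime p x ≤ n := by
  classical exact Nat.find_min' (σ.exists_return p x) ⟨hn, h⟩

theorem Equiv.Perm.firstReturn_injective {α : Type*} [Finite α] (σ : Perm α) (p : α → Prop) :
    Function.Injective (fun x : {x // p x} =>
      (⟨(σ ^ σ.returnTime p x) x, σ.returnTime_spec p x⟩ : {x // p x})) := by
  have key : ∀ x y : {x // p x}, (σ ^ σ.returnTime p x) x.1 = (σ ^ σ.returnTime p y) y.1 →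
      σ.returnTime p x ≤ σ.returnTime p y → x = y := by
    intro x y hxy hle
    obtain ⟨k, hk⟩ := Nat.exists_eq_add_of_le hle
    rw [hk, pow_add, Perm.mul_apply] at hxy
    have h1 : x.1 = (σ ^ k) y.1 := (σ ^ σ.returnTime p x).injective hxy
    rcases Nat.eq_zero_or_pos k with h0 | h0
    · subst h0
      exact Subtype.ext (by simpa using h1)
    · have h2 := σ.returnTime_le p y h0 (h1 ▸ x.2)
      have h3 := σ.returnTime_pos p x
      omega
  intro x y hxy
  have hxy' := congrArg Subtype.val hxy
  rcases le_total (σ.returnTime p x) (σ.returnTime p y) with h | h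
  · exact key x y hxy' h
  · exact (key y x hxy'.symm h).symm

/-- The first-return permutation of `σ` on the elements that satisfy `p`: it sends `x` to the first
of `σ x`, `σ (σ x)`, ... that satisfies `p`.  In cycle notation, it is obtained from `σ` by deleting
from all cycles the elements that do not satisfy `p`. -/
noncomputable def Equiv.Perm.firstReturn {α : Type*} [Finite α] (σ : Perm α) (p : α → Prop) :
    Perm {x // p x} :=
  Equiv.ofBijective
    (fun x => ⟨(σ ^ σ.returnTime p x) x, σ.returnTime_spec p x⟩)
    (Finite.injective_iff_bijective.mp (σ.firstReturn_injective p))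

/-- The number of parts (counted with multiplicity, fixed points included) of the cycle type of
`σ`, regarded as a partition of the number of elements that `σ` permutes. -/
def Equiv.Perm.cycleTypeLength {α : Type*} [Fintype α] [DecidableEq α] (σ : Perm α) : ℕ :=
  Multiset.card σ.partition.parts

/-- A graph with vertex set `V` and set of half-edges `H`, loops and multiple edges allowed.  Each
half-edge is attached to one vertex, and the two half-edges of each edge are exchanged by a
fixed-point-free involution `flip`.  (A loop consists of two half-edges at the same vertex.) -/
structure HalfEdgeGraph (V H : Type*) where
  /-- the vertex at which a half-edge is attached -/
  root : H → V
  /-- the other half of the same edge -/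
  flip : Perm H
  flip_flip : ∀ h, flip (flip h) = h
  flip_ne : ∀ h, flip h ≠ h

namespace HalfEdgeGraph

/-- Two vertices are adjacent if some edge joins them. -/
def Adj {V H : Type*} (G : HalfEdgeGraph V H) (u w : V) : Prop :=
  ∃ h : H, G.root h = u ∧ G.root (G.flip h) = w

/-- The graph has a vertex, and any two vertices are joined by a path. -/
def Connected {V H : Type*} (G : HalfEdgeGraph V H) : Prop :=
  Nonempty V ∧ ∀ u w : V, Relation.ReflTransGen G.Adj u w

/-- The edges are the orbits of `flip`. -/
def Edge {V H : Type*} (G : HalfEdgeGraph V H) : Type _ :=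
  Quotient (Perm.SameCycle.setoid G.flip)

/-- The set of half-edges around a vertex. -/
abbrev HalfEdgesAt {V H : Type*} (G : HalfEdgeGraph V H) (v : V) : Type _ :=
  {h : H // G.root h = v}

/-- The degree of a vertex (a loop counts twice). -/
noncomputable def degree {V H : Type*} (G : HalfEdgeGraph V H) (v : V) : ℕ :=
  Nat.card (G.HalfEdgesAt v)

/-- A 2-cell embedding of the graph on a closed oriented surface, given by its rotation system: a
permutation of the half-edges whose cycles are counterclockwise cyclic orders of the half-edges
around the vertices. -/
structure Embedding {V H : Type*} (G : HalfEdgeGraph V H) where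
  /-- the next half-edge, counterclockwise, around the same vertex -/
  rotation : Perm H
  sameCycle_iff : ∀ h h' : H, rotation.SameCycle h h' ↔ G.root h = G.root h'

namespace Embedding

theorem root_rotation {V H : Type*} {G : HalfEdgeGraph V H} (E : G.Embedding) (h : H) :
    G.root (E.rotation h) = G.root h :=
  ((E.sameCycle_iff h (E.rotation h)).1 ⟨1, by simp⟩).symm

/-- The boundary permutation `γ = αβ`: rotate around the vertex, then pass to the other half of the
edge. -/
def facePerm {V H : Type*} {G : HalfEdgeGraph V H} (E : G.Embedding) : Perm H :=
  G.flip * E.rotation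

/-- The cycles of the boundary permutation, i.e. the boundaries of the faces. -/
def FaceCycle {V H : Type*} {G : HalfEdgeGraph V H} (E : G.Embedding) : Type _ :=
  Quotient (Perm.SameCycle.setoid E.facePerm)

/-- The cycle of the boundary permutation through a half-edge. -/
def faceOf {V H : Type*} {G : HalfEdgeGraph V H} (E : G.Embedding) (h : H) : E.FaceCycle :=
  Quotient.mk (Perm.SameCycle.setoid E.facePerm) h

/-- The number of faces.  The maximum only matters for a graph without edges: a connected one is a
single point on the sphere, which has one face although there are no half-edges. -/
noncomputable def faceCount {V H : Type*} {G : HalfEdgeGraph V H} (E : G.Embedding) : ℕ :=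
  max 1 (Nat.card E.FaceCycle)

/-- The number `q_v` of faces incident to a vertex, i.e. of faces whose boundary contains a half-edge
around `v`.  The maximum only matters if there are no half-edges around `v`: in a connected graph,
`v` is then a single point on the sphere, and is incident to the only face. -/
noncomputable def incidentFaceCount {V H : Type*} {G : HalfEdgeGraph V H} (E : G.Embedding)
    (v : V) : ℕ :=
  max 1 (Set.ncard {f : E.FaceCycle | ∃ h : H, G.root h = v ∧ E.faceOf h = f})

/-- The genus, defined by Euler's formula `2 - 2 * genus = #V - #E + #F`.  For connected graphs the
division by two is exact, see `euler_formula`. -/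
noncomputable def genus {V H : Type*} {G : HalfEdgeGraph V H} (E : G.Embedding) : ℤ :=
  (2 - ((Nat.card V : ℤ) - Nat.card G.Edge + E.faceCount)) / 2

/-- `s_v`: each face incident to `v` is a cyclic sequence of half-edges; delete from it all
half-edges that are not around `v`. -/
noncomputable def localFacePerm {V H : Type*} {G : HalfEdgeGraph V H} [Finite H] (E : G.Embedding)
    (v : V) : Perm (G.HalfEdgesAt v) :=
  E.facePerm.firstReturn (fun h => G.root h = v)

/-- `π_v`: the restriction of the rotation to the half-edges around `v`. -/
def localRotation {V H : Type*} {G : HalfEdgeGraph V H} (E : G.Embedding) (v : V) :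
    Perm (G.HalfEdgesAt v) :=
  E.rotation.subtypePerm (fun h => by rw [E.root_rotation h])

/-- The diagonal `D_v = s_v ∘ π_v⁻¹`. -/
noncomputable def localDiagonal {V H : Type*} {G : HalfEdgeGraph V H} [Finite H] (E : G.Embedding)
    (v : V) : Perm (G.HalfEdgesAt v) :=
  E.localFacePerm v * (E.localRotation v)⁻¹

end Embedding

/-- The minimum genus of the embeddings of a graph. -/
noncomputable def minGenus {V H : Type*} (G : HalfEdgeGraph V H) : ℤ :=
  sInf (Set.range fun E : G.Embedding => E.genus)

/-- The maximum genus of the embeddings of a graph. -/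
noncomputable def maxGenus {V H : Type*} (G : HalfEdgeGraph V H) : ℤ :=
  sSup (Set.range fun E : G.Embedding => E.genus)

end HalfEdgeGraph
theorem Equiv.Perm.natCard_quotient {α : Type*} [Fintype α] [DecidableEq α] (σ : Perm α) :
    Nat.card (Quotient (Perm.SameCycle.setoid σ)) = σ.cycleTypeLength := by
  classical
  let F : α → σ.cycleFactorsFinset ⊕ {x // σ x = x} := fun x =>
    if h : σ x = x then Sum.inr ⟨x, h⟩
    else Sum.inl ⟨σ.cycleOf x, Perm.cycleOf_mem_cycleFactorsFinset_iff.2 (Perm.mem_support.2 h)⟩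
  have hF : ∀ x y, F x = F y ↔ σ.SameCycle x y := by
    intro x y
    by_cases hx : σ x = x <;> by_cases hy : σ y = y
    · simp only [F, hx, hy, dite_true, Sum.inr.injEq, Subtype.mk.injEq]
      exact ⟨fun h => h ▸ Perm.SameCycle.refl _ _, fun h => h.eq_of_left hx⟩
    · simp only [F, hx, hy, dite_true, dite_false, reduceCtorEq, false_iff]
      exact fun h => hy (h.apply_eq_self_iff.1 hx)
    · simp only [F, hx, hy, dite_true, dite_false, reduceCtorEq, false_iff]
      exact fun h => hx (h.apply_eq_self_iff.2 hy)
    · simp only [F, hx, hy, dite_false, Sum.inl.injEq, Subtype.mk.injEq]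
      refine ⟨fun h => ?_, fun h => h.cycleOf_eq⟩
      have : y ∈ (σ.cycleOf x).support := by
        rw [h, Perm.mem_support, Perm.cycleOf_apply_self]; exact hy
      exact (Perm.mem_support_cycleOf_iff.1 this).1
  have e : Function.Bijective (Quotient.lift (s := Perm.SameCycle.setoid σ) F
      (fun x y h => (hF x y).2 h)) := by
    constructor
    · rintro ⟨x⟩ ⟨y⟩ h
      exact Quotient.sound ((hF x y).1 h)
    · rintro (⟨c, hc⟩ | ⟨x, hx⟩)
      · obtain ⟨x, hx⟩ := (Perm.mem_cycleFactorsFinset_iff.1 hc).1.nonempty_support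
        have h1 : σ x ≠ x := by
          rw [← (Perm.mem_cycleFactorsFinset_iff.1 hc).2 x hx]; exact Perm.mem_support.1 hx
        refine ⟨Quotient.mk _ x, ?_⟩
        simp only [Quotient.lift_mk, F, h1, dite_false, Sum.inl.injEq, Subtype.mk.injEq]
        exact (Perm.cycle_is_cycleOf hx hc).symm
      · exact ⟨Quotient.mk _ x, by simp [F, hx]⟩
  rw [Nat.card_congr (Equiv.ofBijective _ e), Nat.card_sum, Nat.card_eq_fintype_card,
    Nat.card_eq_fintype_card, Perm.cycleTypeLength, Perm.parts_partition, Multiset.card_add,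
    Multiset.card_replicate, Perm.cycleType_def, Multiset.card_map, Fintype.card_coe,
    Finset.card_def]
  congr 1
  rw [Fintype.card_subtype, ← Finset.card_compl]
  congr 1
  ext x; simp

theorem Equiv.Perm.sign_eq_cycleTypeLength {α : Type*} [Fintype α] [DecidableEq α] (σ : Perm α) :
    Perm.sign σ = (-1) ^ (Fintype.card α + σ.cycleTypeLength) := by
  have h := σ.support.card_le_univ
  rw [Perm.sign_of_cycleType, Perm.sum_cycleType, Perm.cycleTypeLength, Perm.parts_partition,
    Multiset.card_add, Multiset.card_replicate]
  have : Fintype.card α + (σ.cycleType.card + (Fintype.card α - σ.support.card)) =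
    2 * (Fintype.card α - σ.support.card) + (σ.support.card + σ.cycleType.card) := by omega
  rw [this, pow_add _ (2 * _), pow_mul]; simp

theorem HalfEdgeGraph.Embedding.euler_formula {V H : Type*} {G : HalfEdgeGraph V H}
    [Finite V] [Finite H] (hG : G.Connected) (E : G.Embedding) :
    2 - 2 * E.genus = (Nat.card V : ℤ) - Nat.card G.Edge + E.faceCount := by
  classical
  have := Fintype.ofFinite V
  have := Fintype.ofFinite H
  suffices h : Even ((Nat.card V : ℤ) - Nat.card G.Edge + E.faceCount) by
    obtain ⟨k, hk⟩ := h
    unfold genus; omega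
  obtain ⟨⟨v₀⟩, hc⟩ := hG
  rcases isEmpty_or_nonempty H with hH | ⟨⟨h₀⟩⟩
  · have hV : Nat.card V = 1 := by
      rw [Nat.card_eq_one_iff_unique]
      refine ⟨⟨fun u w => ?_⟩, ⟨v₀⟩⟩
      induction hc u w with
      | refl => rfl
      | tail _ h _ => exact hH.elim h.choose
    have hE : Nat.card G.Edge = 0 := by
      have : IsEmpty G.Edge := ⟨fun e => Quotient.inductionOn e fun h => hH.elim h⟩
      exact Nat.card_of_isEmpty
    have hF : Nat.card E.FaceCycle = 0 := by
      have : IsEmpty E.FaceCycle := ⟨fun e => Quotient.inductionOn e fun h => hH.elim h⟩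
      exact Nat.card_of_isEmpty
    rw [faceCount, hV, hE, hF]; decide
  · have hsurj : Function.Surjective G.root := by
      intro w
      induction hc (G.root h₀) w with
      | refl => exact ⟨_, rfl⟩
      | tail _ h _ => exact ⟨_, h.choose_spec.2⟩
    have hV : Nat.card (Quotient (Perm.SameCycle.setoid E.rotation)) = Nat.card V := by
      refine Nat.card_congr (Equiv.ofBijective (Quotient.lift G.root
        (fun x y h => (E.sameCycle_iff x y).1 h)) ⟨?_, ?_⟩)
      · rintro ⟨x⟩ ⟨y⟩ h
        exact Quotient.sound ((E.sameCycle_iff x y).2 h)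
      · intro w
        obtain ⟨x, hx⟩ := hsurj w
        exact ⟨Quotient.mk _ x, hx⟩
    have hF : E.faceCount = Nat.card E.FaceCycle := by
      have : Nonempty E.FaceCycle := ⟨E.faceOf h₀⟩
      have : Finite E.FaceCycle := Quotient.finite _
      exact max_eq_right Nat.card_pos
    have hs : Perm.sign E.facePerm = Perm.sign G.flip * Perm.sign E.rotation := Perm.sign_mul _ _
    have hn : Even (Fintype.card H) := by
      have hfix : ¬ (∃ a, G.flip a = a) := fun ⟨a, ha⟩ => G.flip_ne a ha
      have h2 : (G.flip) ^ 2 ^ 1 = 1 := by ext x; simp [pow_two, G.flip_flip]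
      have : Fact (Nat.Prime 2) := ⟨Nat.prime_two⟩
      by_contra hodd
      rw [even_iff_two_dvd] at hodd
      exact hfix (Perm.exists_fixed_point_of_prime hodd h2)
    rw [hF, ← hV]
    have e1 := Perm.natCard_quotient E.rotation
    have e2 := Perm.natCard_quotient G.flip
    have e3 := Perm.natCard_quotient E.facePerm
    rw [Perm.sign_eq_cycleTypeLength, Perm.sign_eq_cycleTypeLength, Perm.sign_eq_cycleTypeLength,
      ← e1, ← e2, ← e3, ← pow_add] at hs
    change (-1 : ℤˣ) ^ (_ + Nat.card E.FaceCycle) = (-1) ^ (_ + Nat.card G.Edge + (_ + _)) at hs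
    have h4 := congrArg (fun u : ℤˣ => (u : ℤ)) hs
    simp only [Units.val_pow_eq_pow_val, Units.val_neg, Units.val_one] at h4
    rw [neg_one_pow_eq_ite, neg_one_pow_eq_ite] at h4
    have h5 : Even (Fintype.card H + Nat.card E.FaceCycle) ↔
        Even (Fintype.card H + Nat.card G.Edge +
          (Fintype.card H + Nat.card (Quotient (Perm.SameCycle.setoid E.rotation)))) := by
      split_ifs at h4 with a b b
      · exact iff_of_true a b
      · exact iff_of_false a b
    grind

/-! Only the rotation at a single vertex `v` has to be changed. Replacing `π_v` by `π_v * ρ`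
multiplies the face permutation on the right by `ρ`. Faces that avoid `v` survive, and the
first-return permutation `s_v` becomes `s_v * ρ = D_v * (π_v * ρ)`, so the number of faces changes
by `c(s_v * ρ) - q_v`, where `c` counts cycles (`cycleCount_mul_ofSubtype`, `faceCount_modifyAt`).
By Euler's formula the genus changes by minus half of this.

It remains to choose a full cycle `π'` as the new rotation at `v`. For small genus, some `π'` gives
`D_v * π'` at least `deg(v) + 1 - ℓ(D_v)` cycles (`exists_fullCycle_card_lt_cycleCount_add`). For
large genus, three-cycles merge the `q_v` cycles of `s_v` three at a time, keeping the rotation a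
full cycle, until one or two remain (`exists_fullCycle_mul_cycleCount_add`). Both rest on the fact
that a transposition joins two cycles or splits one. The middle inequality is a parity count at one
vertex. -/

namespace Equiv.Perm

/-! ### Cycle counts and their parity -/

section CycleCount

variable {α : Type*}

/-- The number of cycles of a permutation, fixed points included. -/
noncomputable def cycleCount (σ : Perm α) : ℕ :=
  Nat.card (Quotient (SameCycle.setoid σ))

theorem cycleCount_inv (σ : Perm α) : σ⁻¹.cycleCount = σ.cycleCount := by
  have : SameCycle.setoid σ⁻¹ = SameCycle.setoid σ := Setoid.ext fun x y => sameCycle_inv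
  rw [cycleCount, cycleCount, this]

variable [Finite α]

theorem cycleCount_pos [Nonempty α] (σ : Perm α) : 0 < σ.cycleCount := by
  have : Nonempty (Quotient (SameCycle.setoid σ)) :=
    ⟨Quotient.mk _ (Classical.arbitrary α)⟩
  exact Nat.card_pos

theorem cycleCount_le_card (σ : Perm α) : σ.cycleCount ≤ Nat.card α :=
  Nat.card_le_card_of_surjective _ (Quotient.mk_surjective (s := SameCycle.setoid σ))

omit [Finite α] in
theorem cycleCount_one : (1 : Perm α).cycleCount = Nat.card α := by
  refine (Nat.card_congr (Equiv.ofBijective (Quotient.mk (SameCycle.setoid (1 : Perm α)))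
    ⟨fun x y h => ?_, Quotient.mk_surjective⟩)).symm
  exact sameCycle_one.1 (Quotient.exact h)

omit [Finite α] in
theorem cycleCount_eq_one_iff [Nonempty α] {σ : Perm α} :
    σ.cycleCount = 1 ↔ ∀ x y, σ.SameCycle x y := by
  rw [cycleCount, Nat.card_eq_one_iff_unique]
  constructor
  · rintro ⟨h, -⟩ x y
    exact Quotient.exact (h.elim (Quotient.mk (SameCycle.setoid σ) x) (Quotient.mk _ y))
  · intro h
    refine ⟨⟨?_⟩, ⟨Quotient.mk _ (Classical.arbitrary α)⟩⟩
    rintro ⟨x⟩ ⟨y⟩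
    exact Quotient.sound (h x y)

theorem exists_not_sameCycle {σ : Perm α} (h : 1 < σ.cycleCount) :
    ∃ a b, ¬ σ.SameCycle a b := by
  by_contra! hc
  have : Subsingleton (Quotient (SameCycle.setoid σ)) := by
    refine ⟨?_⟩
    rintro ⟨x⟩ ⟨y⟩
    exact Quotient.sound (hc x y)
  exact absurd (Finite.card_le_one_iff_subsingleton.2 this) (not_le.2 h)

theorem exists_three_not_sameCycle {σ : Perm α} (h : 2 < σ.cycleCount) :
    ∃ a b c, ¬ σ.SameCycle a b ∧ ¬ σ.SameCycle a c ∧ ¬ σ.SameCycle b c := by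
  classical
  have := Fintype.ofFinite (Quotient (SameCycle.setoid σ))
  rw [cycleCount, Nat.card_eq_fintype_card, Fintype.two_lt_card_iff] at h
  obtain ⟨⟨a⟩, ⟨b⟩, ⟨c⟩, hab, hac, hbc⟩ := h
  exact ⟨a, b, c, fun h => hab (Quotient.sound h), fun h => hac (Quotient.sound h),
    fun h => hbc (Quotient.sound h)⟩

/-- The sign of a permutation of `n` points with `c` cycles is `(-1) ^ (n + c)`, and the sign is
multiplicative. -/
theorem even_cycleCount_mul (σ τ : Perm α) :
    Even (Nat.card α + (σ * τ).cycleCount + σ.cycleCount + τ.cycleCount) := by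
  classical
  have := Fintype.ofFinite α
  have h := sign_mul σ τ
  simp only [sign_eq_cycleTypeLength, ← natCard_quotient] at h
  rw [← pow_add] at h
  have h2 := congrArg (fun u => u * (-1 : ℤˣ) ^ (Fintype.card α + (σ * τ).cycleCount)) h
  simp only [cycleCount] at h2
  rw [← pow_add, ← pow_add, Even.neg_one_pow ⟨_, rfl⟩, eq_comm,
    neg_one_pow_eq_one_iff_even (by decide)] at h2
  simp only [cycleCount, Nat.card_eq_fintype_card] at h2 ⊢
  grind

theorem odd_cycleCount_mul_swap [DecidableEq α] (σ : Perm α) {a b : α} (hab : a ≠ b) :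
    Odd ((σ * swap a b).cycleCount + σ.cycleCount) := by
  have := Fintype.ofFinite α
  have h := sign_mul σ (swap a b)
  simp only [sign_swap hab, sign_eq_cycleTypeLength, ← natCard_quotient] at h
  rw [← Nat.not_even_iff_odd]
  intro he
  have h2 := congrArg (fun u => u * (-1 : ℤˣ) ^ (Fintype.card α + (σ * swap a b).cycleCount)) h
  simp only [cycleCount, mul_neg, mul_one, neg_mul] at h2 he
  rw [← pow_add, ← pow_add, Even.neg_one_pow ⟨_, rfl⟩, Even.neg_one_pow (by grind)] at h2
  exact absurd h2 (by decide)

end CycleCount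

end Equiv.Perm

/-! ### Merging two classes of an equivalence relation -/

namespace Setoid

open Classical in
/-- The finest setoid coarser than `r` that relates `a` and `b`. -/
noncomputable def identify {α : Type*} (r : Setoid α) (a b : α) : Setoid α :=
  Setoid.ker fun x : α =>
    if Quotient.mk r x = Quotient.mk r b then Quotient.mk r a else Quotient.mk r x

theorem identify_iff {α : Type*} (r : Setoid α) (a b x y : α) [DecidableEq (Quotient r)] :
    r.identify a b x y ↔
      (if Quotient.mk r x = Quotient.mk r b then Quotient.mk r a else Quotient.mk r x) =
      if Quotient.mk r y = Quotient.mk r b then Quotient.mk r a else Quotient.mk r y := by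
  rw [identify, Setoid.ker_def]
  congr!

theorem le_identify {α : Type*} (r : Setoid α) (a b : α) : r ≤ r.identify a b := by
  intro x y h
  have : Quotient.mk r x = Quotient.mk r y := Quotient.sound h
  classical rw [identify_iff, this]

theorem identify_rel {α : Type*} (r : Setoid α) (a b : α) : r.identify a b a b := by
  classical simp [identify_iff]

theorem identify_le {α : Type*} {r s : Setoid α} {a b : α} (h : r ≤ s) (hab : s a b) :
    r.identify a b ≤ s := by
  classical
  intro x y hxy
  rw [identify_iff] at hxy
  split_ifs at hxy with hx hy hy
  · exact s.trans (h (Quotient.exact hx)) (s.symm (h (Quotient.exact hy)))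
  · exact s.trans (s.trans (h (Quotient.exact hx)) (s.symm hab)) (h (Quotient.exact hxy))
  · exact s.trans (h (Quotient.exact hxy)) (s.trans hab (s.symm (h (Quotient.exact hy))))
  · exact h (Quotient.exact hxy)

theorem identify_eq_self {α : Type*} {r : Setoid α} {a b : α} (hab : r a b) :
    r.identify a b = r :=
  le_antisymm (identify_le le_rfl hab) (le_identify r a b)

/-- The map that defines `identify` takes every class of `r` as a value except that of `b`. -/
theorem natCard_identify {α : Type*} [Finite α] {r : Setoid α} {a b : α} (hab : ¬ r a b) :
    Nat.card (Quotient (r.identify a b)) + 1 = Nat.card (Quotient r) := by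
  classical
  have := Fintype.ofFinite (Quotient r)
  have hne : Quotient.mk r a ≠ Quotient.mk r b := fun h => hab (Quotient.exact h)
  have hr : Set.range (fun x : α =>
      if Quotient.mk r x = Quotient.mk r b then Quotient.mk r a else Quotient.mk r x) =
      {Quotient.mk r b}ᶜ := by
    ext y
    induction y using Quotient.inductionOn with | _ y
    simp only [Set.mem_range, Set.mem_compl_iff, Set.mem_singleton_iff]
    constructor
    · rintro ⟨x, hx⟩
      split_ifs at hx with h
      · exact hx ▸ hne
      · exact hx ▸ h
    · intro h
      exact ⟨y, by rw [if_neg h]⟩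
  have hcard := Nat.card_congr (Setoid.quotientKerEquivRange (fun x : α =>
      if Quotient.mk r x = Quotient.mk r b then Quotient.mk r a else Quotient.mk r x))
  rw [hr] at hcard
  change Nat.card (Quotient (r.identify a b)) = _ at hcard
  have h2 := Set.ncard_add_ncard_compl {Quotient.mk r b}
  rw [Set.ncard_singleton] at h2
  rw [hcard, ← h2, Nat.card_coe_set_eq, add_comm]

end Setoid

/-! ### Multiplication by a transposition -/

namespace Equiv.Perm

theorem sameCycle_setoid_le {α : Type*} [Finite α] {σ : Perm α} {s : Setoid α}
    (h : ∀ x, s x (σ x)) : SameCycle.setoid σ ≤ s := by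
  intro x y hxy
  obtain ⟨n, -, rfl⟩ := SameCycle.exists_pow_eq' (show σ.SameCycle x y from hxy)
  clear hxy
  induction n with
  | zero => exact s.refl _
  | succ n ih =>
    rw [pow_succ', mul_apply]
    exact s.trans ih (h _)

section Swap

variable {α : Type*} [DecidableEq α] [Finite α]

theorem sameCycle_setoid_mul_swap_le (σ : Perm α) (a b : α) :
    SameCycle.setoid (σ * swap a b) ≤ (SameCycle.setoid σ).identify a b := by
  set s := (SameCycle.setoid σ).identify a b
  have hab : s a b := Setoid.identify_rel _ a b
  refine sameCycle_setoid_le fun x => ?_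
  have hσ : ∀ x, s x (σ x) := fun x => Setoid.le_identify _ a b ⟨1, by simp⟩
  rw [mul_apply]
  refine s.trans ?_ (hσ _)
  rw [swap_apply_def]
  split_ifs with h1 h2
  · exact h1 ▸ hab
  · exact h2 ▸ s.symm hab
  · exact s.refl x

/-- Once `a` and `b` are identified, the transposition is invisible. Hence the two cycle counts
differ by at most one, and the sign excludes equality when `a ≠ b`. -/
theorem identify_mul_swap (σ : Perm α) (a b : α) :
    (SameCycle.setoid (σ * swap a b)).identify a b = (SameCycle.setoid σ).identify a b := by
  refine le_antisymm (Setoid.identify_le (sameCycle_setoid_mul_swap_le σ a b)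
    (Setoid.identify_rel _ a b)) (Setoid.identify_le ?_ (Setoid.identify_rel _ a b))
  simpa using sameCycle_setoid_mul_swap_le (σ * swap a b) a b

/-- Multiplication by a transposition joins two cycles. -/
theorem cycleCount_mul_swap_of_not_sameCycle {σ : Perm α} {a b : α} (h : ¬ σ.SameCycle a b) :
    (σ * swap a b).cycleCount + 1 = σ.cycleCount := by
  have hab : a ≠ b := fun e => h (e ▸ SameCycle.refl σ a)
  have h1 := Setoid.natCard_identify (r := SameCycle.setoid σ) h
  have h2 := odd_cycleCount_mul_swap σ hab
  by_cases h3 : (σ * swap a b).SameCycle a b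
  · rw [← identify_mul_swap, Setoid.identify_eq_self h3] at h1
    exact h1
  -- Both relations would lose one class to the same quotient, so the counts would agree, against
  -- the parity `h2`.
  · have h4 := Setoid.natCard_identify (r := SameCycle.setoid (σ * swap a b)) h3
    rw [identify_mul_swap, h1] at h4
    simp only [cycleCount] at h2
    grind

/-- Multiplication by a transposition splits a cycle. -/
theorem cycleCount_mul_swap_of_sameCycle {σ : Perm α} {a b : α} (hab : a ≠ b)
    (h : σ.SameCycle a b) : (σ * swap a b).cycleCount = σ.cycleCount + 1 := by
  have h2 := odd_cycleCount_mul_swap σ hab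
  have h1 : (SameCycle.setoid (σ * swap a b)).identify a b = SameCycle.setoid σ := by
    rw [identify_mul_swap, Setoid.identify_eq_self h]
  by_cases h3 : (σ * swap a b).SameCycle a b
  · rw [Setoid.identify_eq_self h3] at h1
    simp only [cycleCount] at h2
    rw [h1] at h2
    grind
  · have h4 := Setoid.natCard_identify (r := SameCycle.setoid (σ * swap a b)) h3
    rw [h1] at h4
    exact h4.symm

/-- Otherwise the same transposition would split a cycle twice in succession, although applying it
twice gives back `σ`. -/
theorem not_sameCycle_mul_swap {σ : Perm α} {a b : α} (hab : a ≠ b) (h : σ.SameCycle a b) :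
    ¬ (σ * swap a b).SameCycle a b := by
  intro h3
  have h1 := cycleCount_mul_swap_of_sameCycle hab h
  have h2 := cycleCount_mul_swap_of_sameCycle hab h3
  rw [mul_assoc, swap_mul_self, mul_one] at h2
  omega

theorem cycleCount_le_mul_swap_add_one (σ : Perm α) (a b : α) :
    σ.cycleCount ≤ (σ * swap a b).cycleCount + 1 := by
  by_cases hab : a = b
  · rw [hab, swap_self, ← one_def, mul_one]; omega
  by_cases h : σ.SameCycle a b
  · rw [cycleCount_mul_swap_of_sameCycle hab h]; omega
  · rw [cycleCount_mul_swap_of_not_sameCycle h]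

end Swap

/-! ### Full cycles with many or few cycles in a product -/

/-- Every permutation `δ` has a product with a full cycle that has as many cycles as the
Riemann-Hurwitz formula allows. -/
theorem exists_fullCycle_card_lt_cycleCount_add {α : Type*} [Finite α] [Nonempty α]
    (δ : Perm α) :
    ∃ π : Perm α, π.cycleCount = 1 ∧ Nat.card α + 1 ≤ (π * δ).cycleCount + δ.cycleCount := by
  classical
  induction hn : δ.cycleCount using Nat.strong_induction_on generalizing δ with | _ n ih
  subst hn
  by_cases h1 : δ.cycleCount = 1
  · exact ⟨δ⁻¹, by rw [cycleCount_inv, h1], by rw [inv_mul_cancel, cycleCount_one, h1]⟩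
  have h2 := δ.cycleCount_pos
  obtain ⟨a, b, hab⟩ := exists_not_sameCycle (σ := δ) (by omega)
  have h3 := cycleCount_mul_swap_of_not_sameCycle hab
  obtain ⟨π, hπ, h⟩ := ih _ (by omega) (δ * swap a b) rfl
  -- Undoing the transposition gives `δ` one more cycle and costs the product at most one.
  have h4 := cycleCount_le_mul_swap_add_one (π * (δ * swap a b)) a b
  rw [mul_assoc, mul_assoc, swap_mul_self, mul_one] at h4
  exact ⟨π, hπ, by omega⟩

/-- Three cycles of `σ` can be joined into one by multiplication with a three-cycle, the orientation
of which can be chosen such that the product of a given full cycle with it is a full cycle. -/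
theorem exists_fullCycle_mul_cycleCount_add_two {α : Type*} [Finite α] [Nonempty α]
    {π σ : Perm α} (hπ : π.cycleCount = 1) (hσ : 2 < σ.cycleCount) :
    ∃ ρ : Perm α, (π * ρ).cycleCount = 1 ∧ (σ * ρ).cycleCount + 2 = σ.cycleCount := by
  classical
  obtain ⟨a, b, c, hab, hac, hbc⟩ := exists_three_not_sameCycle hσ
  have key : ∀ a b c : α, ¬ σ.SameCycle a b → ¬ σ.SameCycle a c → ¬ σ.SameCycle b c →
      ¬ (π * swap a b).SameCycle a c →
      ∃ ρ : Perm α, (π * ρ).cycleCount = 1 ∧ (σ * ρ).cycleCount + 2 = σ.cycleCount := by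
    intro a b c hab hac hbc h
    have hne : a ≠ b := fun e => hab (e ▸ SameCycle.refl σ a)
    have h1 := cycleCount_mul_swap_of_sameCycle hne (cycleCount_eq_one_iff.1 hπ a b)
    have h2 := cycleCount_mul_swap_of_not_sameCycle h
    have h3 := cycleCount_mul_swap_of_not_sameCycle hab
    have h4 : ¬ (σ * swap a b).SameCycle a c := by
      intro h4
      have h5 := sameCycle_setoid_mul_swap_le σ a b h4
      rw [Setoid.identify_iff] at h5
      have e1 : Quotient.mk (SameCycle.setoid σ) a ≠ Quotient.mk _ b :=
        fun e => hab (Quotient.exact e)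
      have e2 : Quotient.mk (SameCycle.setoid σ) c ≠ Quotient.mk _ b :=
        fun e => hbc (Quotient.exact e.symm)
      rw [if_neg e1, if_neg e2] at h5
      exact hac (Quotient.exact h5)
    have h5 := cycleCount_mul_swap_of_not_sameCycle h4
    exact ⟨swap a b * swap a c, by rw [← mul_assoc]; omega, by rw [← mul_assoc]; omega⟩
  -- The transposition splits the full cycle `π` into two, separating `a` from `b`. If `c` lies with
  -- `a`, it does not lie with `b`, and the roles of `a` and `b` are exchanged.
  by_cases h : (π * swap a b).SameCycle a c
  · refine key b a c (fun h => hab h.symm) hbc hac fun h' => ?_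
    rw [swap_comm] at h'
    have hne : a ≠ b := fun e => hab (e ▸ SameCycle.refl σ a)
    exact not_sameCycle_mul_swap hne (cycleCount_eq_one_iff.1 hπ a b) (h.trans h'.symm)
  · exact key a b c hab hac hbc h

theorem exists_fullCycle_mul_cycleCount_add {α : Type*} [Finite α] [Nonempty α]
    {π σ : Perm α} (hπ : π.cycleCount = 1) :
    ∃ ρ : Perm α, (π * ρ).cycleCount = 1 ∧
      (σ * ρ).cycleCount + 2 * ((σ.cycleCount - 1) / 2) = σ.cycleCount := by
  induction hn : σ.cycleCount using Nat.strong_induction_on generalizing π σ with | _ n ih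
  subst hn
  by_cases h : 2 < σ.cycleCount
  · obtain ⟨ρ, h1, h2⟩ := exists_fullCycle_mul_cycleCount_add_two hπ h
    obtain ⟨τ, h3, h4⟩ := ih (σ * ρ).cycleCount (by omega) h1 rfl
    exact ⟨ρ * τ, by rwa [← mul_assoc], by rw [← mul_assoc]; omega⟩
  · exact ⟨1, by rwa [mul_one], by rw [mul_one]; omega⟩

/-! ### First-return permutations -/

section FirstReturn

variable {α : Type*} [Finite α]

theorem firstReturn_apply (σ : Perm α) (p : α → Prop) (x : {x // p x}) :
    (σ.firstReturn p x : α) = (σ ^ σ.returnTime p x) x := rfl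

theorem not_of_lt_returnTime (σ : Perm α) (p : α → Prop) (x : {x // p x}) {n : ℕ} (hn : 0 < n)
    (h : n < σ.returnTime p x) : ¬ p ((σ ^ n) x) :=
  fun hp => absurd (σ.returnTime_le p x hn hp) (not_le.2 h)

theorem sameCycle_firstReturn_iff (σ : Perm α) (p : α → Prop) (x y : {x // p x}) :
    (σ.firstReturn p).SameCycle x y ↔ σ.SameCycle x y := by
  constructor
  · refine @sameCycle_setoid_le _ _ _ ((SameCycle.setoid σ).comap Subtype.val) (fun x => ?_) x y
    exact ⟨σ.returnTime p x, by rw [zpow_natCast]; rfl⟩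
  · intro h
    obtain ⟨n, -, hn⟩ := h.exists_pow_eq'
    clear h
    induction n using Nat.strong_induction_on generalizing x with | _ n ih
    rcases Nat.eq_zero_or_pos n with h0 | h0
    · subst h0
      exact Subtype.ext (show x.1 = y.1 by simpa using hn) ▸ SameCycle.refl _ x
    · have h1 := σ.returnTime_le p x h0 (hn ▸ y.2)
      have h2 := σ.returnTime_pos p x
      have h3 := ih (n - σ.returnTime p x) (by omega) (σ.firstReturn p x) (by
        rw [firstReturn_apply, ← mul_apply, ← pow_add, Nat.sub_add_cancel h1, hn])
      exact sameCycle_apply_left.1 h3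

theorem firstReturn_eq_of_pow (σ : Perm α) (p : α → Prop) (x y : {x // p x}) {n : ℕ}
    (hn : 0 < n) (hy : (σ ^ n) x = y) (h : ∀ m, 0 < m → m < n → ¬ p ((σ ^ m) x)) :
    σ.firstReturn p x = y := by
  have h1 := σ.returnTime_le p x hn (hy ▸ y.2)
  have h2 : σ.returnTime p x = n := by
    by_contra hne
    exact h _ (σ.returnTime_pos p x) (by omega) (σ.returnTime_spec p x)
  exact Subtype.ext (by rw [firstReturn_apply, h2, hy])

-- An orbit meets `ofSubtype ρ` nontrivially only at its start: until the next return it stays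
-- outside `p`, where `ofSubtype ρ` is the identity.
open Classical in
theorem firstReturn_mul_ofSubtype (σ : Perm α) (p : α → Prop) (ρ : Perm {x // p x}) :
    (σ * ofSubtype ρ).firstReturn p = σ.firstReturn p * ρ := by
  ext1 x
  have key : ∀ n, 0 < n → n ≤ σ.returnTime p (ρ x) →
      ((σ * ofSubtype ρ) ^ n) x = (σ ^ n) (ρ x) := by
    intro n hn
    induction n, hn using Nat.le_induction with
    | base => intro _; simp
    | succ n hn ih =>
      intro hle
      rw [pow_succ', mul_apply, ih (by omega), mul_apply, pow_succ', mul_apply,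
        ofSubtype_apply_of_not_mem ρ (not_of_lt_returnTime σ p (ρ x) hn (by omega))]
  refine firstReturn_eq_of_pow _ p x _ (σ.returnTime_pos p (ρ x))
    (key _ (σ.returnTime_pos p (ρ x)) le_rfl) fun m hm hlt => ?_
  rw [key m hm hlt.le]
  exact not_of_lt_returnTime σ p (ρ x) hm hlt

open Classical in
/-- The cycles that do not meet `{x | p x}` are unaffected by a multiplication with a permutation
supported on this set. -/
theorem cycleCount_mul_ofSubtype (σ : Perm α) (p : α → Prop) (ρ : Perm {x // p x}) :
    (σ * ofSubtype ρ).cycleCount + (σ.firstReturn p).cycleCount =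
      σ.cycleCount + (σ.firstReturn p * ρ).cycleCount := by
  induction ρ using swap_induction_on generalizing σ with
  | one => simp
  | swap_mul ρ a b hab ih =>
    have h := ih (σ * ofSubtype (swap a b))
    rw [firstReturn_mul_ofSubtype, mul_assoc, ← map_mul, mul_assoc] at h
    -- For one transposition, `σ` and its first return agree on whether `a` and `b` share a cycle,
    -- so both counts move by one in the same direction.
    suffices h2 : (σ * ofSubtype (swap a b)).cycleCount + (σ.firstReturn p).cycleCount =
        σ.cycleCount + (σ.firstReturn p * swap a b).cycleCount by omega
    have hab' : (a : α) ≠ b := fun e => hab (Subtype.ext e)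
    rw [ofSubtype_swap_eq]
    by_cases hs : σ.SameCycle a b
    · rw [cycleCount_mul_swap_of_sameCycle hab' hs,
        cycleCount_mul_swap_of_sameCycle hab ((sameCycle_firstReturn_iff σ p a b).2 hs)]
      omega
    · have h3 := cycleCount_mul_swap_of_not_sameCycle hs
      have h4 := cycleCount_mul_swap_of_not_sameCycle
        (mt (sameCycle_firstReturn_iff σ p a b).1 hs)
      omega

end FirstReturn

end Equiv.Perm

/-! ### Changing the rotation at one vertex -/

namespace HalfEdgeGraph

variable {V H : Type*} {G : HalfEdgeGraph V H}

namespace Embedding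

theorem cycleCount_localRotation [Finite H] (E : G.Embedding) (v : V)
    [Nonempty (G.HalfEdgesAt v)] : (E.localRotation v).cycleCount = 1 := by
  rw [Perm.cycleCount_eq_one_iff]
  intro x y
  rw [localRotation, Perm.sameCycle_subtypePerm, E.sameCycle_iff, x.2, y.2]

open Classical in
/-- The embedding with the rotation `π` around `v` replaced by `π * ρ`. -/
noncomputable def modifyAt [Finite H] (E : G.Embedding) (v : V) [Nonempty (G.HalfEdgesAt v)]
    (ρ : Perm (G.HalfEdgesAt v)) (hρ : (E.localRotation v * ρ).cycleCount = 1) :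
    G.Embedding where
  rotation := E.rotation * Perm.ofSubtype ρ
  sameCycle_iff h h' := by
    have hroot : ∀ h, G.root ((E.rotation * Perm.ofSubtype ρ) h) = G.root h := by
      intro h
      rw [Perm.mul_apply, E.root_rotation]
      by_cases hv : G.root h = v
      · rw [Perm.ofSubtype_apply_of_mem ρ hv, hv]
        exact (ρ ⟨h, hv⟩).2
      · rw [Perm.ofSubtype_apply_of_not_mem ρ hv]
    constructor
    · exact fun hc => @Perm.sameCycle_setoid_le _ _ _ (Setoid.ker G.root)
        (fun x => (hroot x).symm) h h' hc
    · intro hh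
      by_cases hv : G.root h = v
      · have h1 := Perm.cycleCount_eq_one_iff.1 hρ ⟨h, hv⟩ ⟨h', hh ▸ hv⟩
        have h2 : E.localRotation v * ρ = (E.rotation * Perm.ofSubtype ρ).subtypePerm
            (p := fun h => G.root h = v) (fun h => by rw [hroot]) := by
          ext x
          simp [localRotation]
        rwa [h2, Perm.sameCycle_subtypePerm] at h1
      -- Around any other vertex, old and new rotation have the same restriction.
      · have h1 := (E.sameCycle_iff h h').2 hh
        have h2 : (E.rotation * Perm.ofSubtype ρ).subtypePerm
            (p := fun x => G.root x = G.root h) (fun x => by rw [hroot]) =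
            E.rotation.subtypePerm (fun x => by rw [E.root_rotation]) := by
          ext x
          have hx : G.root x ≠ v := fun e => hv (x.2 ▸ e)
          simp [Perm.ofSubtype_apply_of_not_mem ρ hx]
        have h3 := Perm.sameCycle_subtypePerm (h := fun x => by rw [E.root_rotation])
          (x := (⟨h, rfl⟩ : {x // G.root x = G.root h})) (y := ⟨h', hh.symm⟩) |>.2 h1
        rwa [← h2, Perm.sameCycle_subtypePerm] at h3

theorem incidentFaceCount_eq_cycleCount [Finite H] (E : G.Embedding) (v : V)
    [Nonempty (G.HalfEdgesAt v)] : E.incidentFaceCount v = (E.localFacePerm v).cycleCount := by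
  let f : Quotient (Perm.SameCycle.setoid (E.localFacePerm v)) → E.FaceCycle :=
    Quotient.lift (fun x => E.faceOf x.1)
      (fun x y h => Quotient.sound ((Perm.sameCycle_firstReturn_iff _ _ x y).1 h))
  have hf : Function.Injective f := by
    rintro ⟨x⟩ ⟨y⟩ h
    exact Quotient.sound ((Perm.sameCycle_firstReturn_iff _ _ x y).2 (Quotient.exact h))
  have hr : {g : E.FaceCycle | ∃ h : H, G.root h = v ∧ E.faceOf h = g} = Set.range f := by
    ext g
    constructor
    · rintro ⟨h, hv, rfl⟩
      exact ⟨Quotient.mk _ ⟨h, hv⟩, rfl⟩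
    · rintro ⟨⟨x⟩, rfl⟩
      exact ⟨x.1, x.2, rfl⟩
  have h1 : Set.ncard (Set.range f) = (E.localFacePerm v).cycleCount := by
    rw [← Nat.card_coe_set_eq]
    exact (Nat.card_congr (Equiv.ofInjective f hf)).symm
  rw [incidentFaceCount, hr, h1]
  exact max_eq_right (E.localFacePerm v).cycleCount_pos

theorem incidentFaceCount_of_isEmpty (E : G.Embedding) (v : V) [IsEmpty (G.HalfEdgesAt v)] :
    E.incidentFaceCount v = 1 := by
  have : {g : E.FaceCycle | ∃ h : H, G.root h = v ∧ E.faceOf h = g} = ∅ := by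
    ext g
    simp only [Set.mem_ofPred_eq, Set.mem_empty_iff_false, iff_false]
    rintro ⟨h, hv, -⟩
    exact isEmptyElim (⟨h, hv⟩ : G.HalfEdgesAt v)
  rw [incidentFaceCount, this, Set.ncard_empty]
  rfl

theorem faceCount_eq_cycleCount [Finite H] [Nonempty H] (E : G.Embedding) :
    E.faceCount = E.facePerm.cycleCount :=
  max_eq_right E.facePerm.cycleCount_pos

theorem faceCount_modifyAt [Finite H] (E : G.Embedding) (v : V) [Nonempty (G.HalfEdgesAt v)]
    (ρ : Perm (G.HalfEdgesAt v)) (hρ : (E.localRotation v * ρ).cycleCount = 1) :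
    (E.modifyAt v ρ hρ).faceCount + E.incidentFaceCount v =
      E.faceCount + (E.localFacePerm v * ρ).cycleCount := by
  have : Nonempty H := ⟨(Classical.arbitrary (G.HalfEdgesAt v)).1⟩
  rw [faceCount_eq_cycleCount, faceCount_eq_cycleCount, incidentFaceCount_eq_cycleCount]
  exact Perm.cycleCount_mul_ofSubtype E.facePerm (fun h => G.root h = v) ρ

theorem localDiagonal_mul_localRotation [Finite H] (E : G.Embedding) (v : V) :
    E.localDiagonal v * E.localRotation v = E.localFacePerm v :=
  inv_mul_cancel_right _ _

theorem exists_genus_le [Finite H] (E : G.Embedding) (v : V) :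
    ∃ E' : G.Embedding, E'.genus ≤ E.genus + -(((G.degree v : ℤ) + 1
      - (E.localDiagonal v).cycleCount - E.incidentFaceCount v) / 2) := by
  rcases isEmpty_or_nonempty (G.HalfEdgesAt v) with hv | hv
  · refine ⟨E, ?_⟩
    have h1 : G.degree v = 0 := Nat.card_of_isEmpty
    -- With the default `q_v = 1` at an isolated vertex, the correction is nonnegative, so `E`
    -- itself serves.
    rw [h1, E.incidentFaceCount_of_isEmpty v]
    omega
  · obtain ⟨π, hπ, h⟩ :=
      Perm.exists_fullCycle_card_lt_cycleCount_add (E.localDiagonal v)⁻¹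
    -- Inversion turns `π * D_v⁻¹` into `D_v * π⁻¹`, so `π⁻¹` is the new rotation at `v`.
    rw [Perm.cycleCount_inv, ← Perm.cycleCount_inv (π * _), mul_inv_rev, inv_inv] at h
    have h1 : (E.localRotation v * ((E.localRotation v)⁻¹ * π⁻¹)).cycleCount = 1 := by
      rw [mul_inv_cancel_left, Perm.cycleCount_inv, hπ]
    refine ⟨E.modifyAt v _ h1, ?_⟩
    have h2 := E.faceCount_modifyAt v _ h1
    rw [← mul_assoc] at h2
    change _ = _ + (E.localDiagonal v * π⁻¹).cycleCount at h2
    unfold genus degree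
    -- Here `⌊(x - k) / 2⌋ ≤ ⌊x / 2⌋ - ⌊k / 2⌋` holds for all integers, so exactness of the division
    -- in the genus is not needed.
    omega

theorem exists_le_genus [Finite H] (E : G.Embedding) (v : V) :
    ∃ E' : G.Embedding, E.genus + ((E.incidentFaceCount v : ℤ) - 1) / 2 ≤ E'.genus := by
  rcases isEmpty_or_nonempty (G.HalfEdgesAt v) with hv | hv
  · exact ⟨E, by rw [E.incidentFaceCount_of_isEmpty v]; simp⟩
  · obtain ⟨ρ, hρ, h⟩ := Perm.exists_fullCycle_mul_cycleCount_add (σ := E.localFacePerm v)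
      (E.cycleCount_localRotation v)
    refine ⟨E.modifyAt v ρ hρ, ?_⟩
    have h1 := E.faceCount_modifyAt v ρ hρ
    have h2 := (E.localFacePerm v).cycleCount_pos
    rw [← E.incidentFaceCount_eq_cycleCount v] at h h2
    unfold genus
    omega

/-- If `v` has half-edges, the sign of `s_v = D_v * π_v` makes the numerator on the left even. The
floor there is then exact, and `ℓ(D_v) ≤ deg(v)` suffices. -/
theorem neg_half_le_half_incidentFaceCount [Finite H] (E : G.Embedding) (v : V) :
    -(((G.degree v : ℤ) + 1 - (E.localDiagonal v).cycleCount - E.incidentFaceCount v) / 2) ≤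
      ((E.incidentFaceCount v : ℤ) - 1) / 2 := by
  have h1 : (E.localDiagonal v).cycleCount ≤ G.degree v := Perm.cycleCount_le_card _
  rcases isEmpty_or_nonempty (G.HalfEdgesAt v) with hv | hv
  · rw [E.incidentFaceCount_of_isEmpty v]
    omega
  · have h2 := Perm.even_cycleCount_mul (E.localDiagonal v) (E.localRotation v)
    rw [localDiagonal_mul_localRotation, cycleCount_localRotation,
      ← E.incidentFaceCount_eq_cycleCount v] at h2
    change Even (G.degree v + _ + _ + 1) at h2
    obtain ⟨k, hk⟩ := h2
    omega

theorem rotation_injective :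
    Function.Injective (rotation : G.Embedding → Perm H) := by
  rintro ⟨r, _⟩ ⟨_, _⟩ rfl
  rfl

instance [Finite H] : Finite G.Embedding :=
  Finite.of_injective _ rotation_injective

end Embedding

theorem minGenus_le [Finite H] (E : G.Embedding) : G.minGenus ≤ E.genus :=
  csInf_le (Set.finite_range _).bddBelow ⟨E, rfl⟩

theorem le_maxGenus [Finite H] (E : G.Embedding) : E.genus ≤ G.maxGenus :=
  le_csSup (Set.finite_range _).bddAbove ⟨E, rfl⟩

end HalfEdgeGraph

theorem theorem4p3 {V H : Type*} [Fintype V] [DecidableEq V] [Fintype H] [DecidableEq H]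
    (G : HalfEdgeGraph V H) (hG : G.Connected) (E : G.Embedding) (T₁ T₂ : ℤ)
    (hT₁ : T₁ = ⨅ v : V,
      -(((G.degree v : ℤ) + 1 - (E.localDiagonal v).cycleTypeLength - E.incidentFaceCount v) / 2))
    (hT₂ : T₂ = ⨆ v : V, ((E.incidentFaceCount v : ℤ) - 1) / 2) :
    G.minGenus ≤ E.genus + T₁ ∧
      E.genus + T₁ ≤ E.genus + T₂ ∧
      E.genus + T₂ ≤ G.maxGenus := by
  have : Nonempty V := hG.1
  simp only [← Perm.natCard_quotient] at hT₁
  change T₁ = ⨅ v : V, -(((G.degree v : ℤ) + 1 - (E.localDiagonal v).cycleCount -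
    E.incidentFaceCount v) / 2) at hT₁
  -- Both extrema are attained, as there are finitely many vertices and at least one; each genus
  -- bound then needs only one vertex.
  obtain ⟨u, hu⟩ := exists_eq_ciInf_of_finite (f := fun v : V =>
    -(((G.degree v : ℤ) + 1 - (E.localDiagonal v).cycleCount - E.incidentFaceCount v) / 2))
  obtain ⟨w, hw⟩ := exists_eq_ciSup_of_finite (f := fun v : V =>
    ((E.incidentFaceCount v : ℤ) - 1) / 2)
  rw [← hu] at hT₁
  obtain ⟨E₁, h₁⟩ := E.exists_genus_le u
  obtain ⟨E₂, h₂⟩ := E.exists_le_genus w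
  refine ⟨hT₁ ▸ (HalfEdgeGraph.minGenus_le E₁).trans h₁, ?_, ?_⟩
  · rw [hT₁, hT₂]
    exact add_le_add_right ((E.neg_half_le_half_incidentFaceCount u).trans
      (le_ciSup (f := fun v : V => ((E.incidentFaceCount v : ℤ) - 1) / 2)
        (Set.finite_range _).bddAbove u)) _
  · rw [hT₂, ← hw]
    exact h₂.trans (HalfEdgeGraph.le_maxGenus E₂)
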